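/- Let $X$ be an uncountable Polish space and let $1\le\xi<\omega_1$. A function $X\to\mathbb R$ is of Baire class $0$ if it is continuous, and of Baire class $\zeta\ge 1$ if it is the pointwise limit of a sequence of functions $f_n$ of Baire class $\zeta_n<\zeta$. Let $\boldsymbol\Sigma^0_\zeta,\boldsymbol\Pi^0_\zeta,\boldsymbol\Delta^0_\zeta$ denote the additive, multiplicative and ambiguous Borel classes of subsets of $X$. Let $\lambda$ be an ordinal and let $(F_\eta)_{\eta<\lambda}$ be a decreasing sequence of $\boldsymbol\Pi^0_\xi$ sets with $F_0=X$ that is continuous, i.e. $F_\eta=\bigcap_{\theta<\eta}F_\theta$ for every limit $\eta<\lambda$, and $\bigcap_{\eta<\lambda}F_\eta=\emptyset$ if $\lambda$ is a limit; put $F_\eta=\emptyset$ for $\eta\ge\lambda$. Its transfinite difference is $\bigcup_{\eta<\lambda,\ \eta\text{ even}}(F_\eta\setminus F_{\eta+1})$. For $A,B\subseteq X$ let $\alpha_\xi(A,B)$ be the least length $\lambda<\omega_1$ of such a sequence whose transfinite difference contains $A$ and is disjoint from $B$ (and $\omega_1$ if there is none). For $f$ of Baire class $\xi$ let $$\alpha_\xi(f)=\sup_{p<q,\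 p,q\in\mathbb Q}\alpha_\xi(\{f\le p\},\{f\ge q\}),$$ and for $f$ bounded and of Baire class $\xi$ let $$\delta_{fin}(f)=\sup_{\varepsilon>0}\ \min\ \max_{n\le N}\alpha_\xi(H_n,X\setminus H_n),$$ where the minimum is over all $N\in\mathbb N$ and all partitions of $X$ into pairwise disjoint, possibly empty sets $H_0,\dots,H_N\in\boldsymbol\Delta^0_{\xi+1}$ for which there are $c_0,\dots,c_N\in\mathbb R$ with $\left|f-\sum_{n\le N}c_n\chi_{H_n}\right|\le\varepsilon$ on $X$ (and the minimum is $\omega_1$ if there is no such partition). For ordinals $\theta,\theta'<\omega_1$ write $\theta\lesssim\theta'$ if for every $1\le\eta<\omega_1$, $\theta'\le\omega^\eta$ implies $\theta\le\omega^\eta$ (ordinal exponentiation), and write $\theta\approx\theta'$ if $\theta\lesssim\theta'$ and $\theta'\lesssim\theta$. Theorem. For every bounded function $f:X\to\mathbb R$ of Baire class $\xi$, both $\delta_{fin}(f)$ and $\alpha_\xi(f)$ are countable ordinals, and $\delta_{fin}(f)\approx\alpha_\xi(f)$. -/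

import Mathlib

open Set Filter Topology
open scoped Ordinal

noncomputable section

namespace BaireRank

/-- The additive Borel classes `Σ⁰_ξ`, `ξ ≥ 1` : `Σ⁰_1` consists of the open sets, and for `ξ > 1`
the class `Σ⁰_ξ` consists of the unions `⋃ n, A n` where each `A n` is the complement of a
`Σ⁰_{ν n}` set (i.e. is `Π⁰_{ν n}`) for some `1 ≤ ν n < ξ`. -/
inductive IsSigma0 {X : Type*} [TopologicalSpace X] : Ordinal.{0} → Set X → Prop
  | of_isOpen {U : Set X} (hU : IsOpen U) : IsSigma0 1 U
  | iUnion {ξ : Ordinal.{0}} {S : Set X} (ν : ℕ → Ordinal.{0}) (A : ℕ → Set X)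
      (h1 : ∀ n, 1 ≤ ν n) (hlt : ∀ n, ν n < ξ) (hA : ∀ n, IsSigma0 (ν n) (A n)ᶜ)
      (hS : S = ⋃ n, A n) : IsSigma0 ξ S

/-- The multiplicative Borel classes `Π⁰_ξ`. -/
def IsPi0 {X : Type*} [TopologicalSpace X] (ξ : Ordinal.{0}) (S : Set X) : Prop :=
  IsSigma0 ξ Sᶜ

/-- The ambiguous Borel classes `Δ⁰_ξ`. -/
def IsDelta0 {X : Type*} [TopologicalSpace X] (ξ : Ordinal.{0}) (S : Set X) : Prop :=
  IsSigma0 ξ S ∧ IsPi0 ξ S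

/-- Real functions of Baire class `ξ` : class `0` consists of the continuous functions, and for
`ξ ≥ 1` the class `ξ` consists of the pointwise limits of sequences `g n` of functions of
Baire class `ν n < ξ`. -/
inductive IsBaireClass {X : Type*} [TopologicalSpace X] : Ordinal.{0} → (X → ℝ) → Prop
  | of_continuous {f : X → ℝ} (hf : Continuous f) : IsBaireClass 0 f
  | of_tendsto {ξ : Ordinal.{0}} {f : X → ℝ} (ν : ℕ → Ordinal.{0}) (g : ℕ → X → ℝ)
      (hlt : ∀ n, ν n < ξ) (hg : ∀ n, IsBaireClass (ν n) (g n))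
      (hlim : ∀ x, Tendsto (fun n => g n x) atTop (𝓝 (f x))) : IsBaireClass ξ f

/-- Even ordinals: those of the form `μ + 2 * k` with `μ` zero or limit and `k < ω`; these are
exactly the ordinals `2 * θ` (as `2 * (ω * a + k) = ω * a + 2 * k`). -/
def IsEvenOrd (η : Ordinal.{0}) : Prop := ∃ θ : Ordinal.{0}, η = 2 * θ

/-- `(F η)_{η < L}` is a decreasing continuous sequence of `Π⁰_ξ` sets with `F 0 = X`, extended by
`F η = ∅` for `η ≥ L`. -/
structure IsDiffSeq {X : Type*} [TopologicalSpace X] (ξ L : Ordinal.{0})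
    (F : Ordinal.{0} → Set X) : Prop where
  isPi0 : ∀ η, η < L → IsPi0 ξ (F η)
  zero : F 0 = univ
  antitone : ∀ η θ, η ≤ θ → F θ ⊆ F η
  continuous : ∀ η, η < L → Order.IsSuccLimit η → F η = ⋂ θ, ⋂ (_ : θ < η), F θ
  iInter_eq_empty : Order.IsSuccLimit L → ⋂ θ, ⋂ (_ : θ < L), F θ = ∅
  eq_empty : ∀ η, L ≤ η → F η = ∅

/-- The transfinite difference of `(F η)_{η < L}`: the union of `F η \ F (η + 1)` over even
`η < L`. -/
def transDiff {X : Type*} (L : Ordinal.{0}) (F : Ordinal.{0} → Set X) : Set X :=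
  {x | ∃ η, η < L ∧ IsEvenOrd η ∧ x ∈ F η ∧ x ∉ F (η + 1)}

/-- `α_ξ(A, B)`: the least countable length of a sequence of `Π⁰_ξ` sets as above whose transfinite
difference contains `A` and is disjoint from `B`; it is `ω₁` if there is no such sequence. -/
def sepRankSets {X : Type*} [TopologicalSpace X] (ξ : Ordinal.{0}) (A B : Set X) : Ordinal.{0} :=
  sInf (insert ω₁ {L : Ordinal.{0} | L < ω₁ ∧ ∃ F : Ordinal.{0} → Set X, IsDiffSeq ξ L F ∧
    A ⊆ transDiff L F ∧ transDiff L F ⊆ Bᶜ})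

/-- The separation rank `α_ξ(f)`. -/
def sepRank {X : Type*} [TopologicalSpace X] (ξ : Ordinal.{0}) (f : X → ℝ) : Ordinal.{0} :=
  ⨆ r : {r : ℚ × ℚ // r.1 < r.2},
    sepRankSets ξ {x | f x ≤ (r.1.1 : ℝ)} {x | (r.1.2 : ℝ) ≤ f x}

/-- `H 0, …, H N` is a partition of `X` into (possibly empty) `Δ⁰_{ξ+1}` sets such that `f` is
within `ε` of some step function `∑ n, c n * χ_{H n}`. -/
structure IsApproxPartition {X : Type*} [TopologicalSpace X] (ξ : Ordinal.{0}) (f : X → ℝ) (ε : ℝ)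
    (N : ℕ) (H : Fin (N + 1) → Set X) : Prop where
  isDelta0 : ∀ n, IsDelta0 (ξ + 1) (H n)
  iUnion_eq : ⋃ n, H n = univ
  disjoint : ∀ n m, n ≠ m → H n ∩ H m = ∅
  approx : ∃ c : Fin (N + 1) → ℝ, ∀ x,
    |f x - ∑ n, c n * (H n).indicator (fun _ => (1 : ℝ)) x| ≤ ε

/-- The least value of `max_{n ≤ N} α_ξ(H n, (H n)ᶜ)` over all finite partitions as above, for a
given `ε` (and `ω₁` if there is no such partition). -/
def finPartRankAt {X : Type*} [TopologicalSpace X] (ξ : Ordinal.{0}) (f : X → ℝ) (ε : ℝ) :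
    Ordinal.{0} :=
  sInf (insert ω₁ {r : Ordinal.{0} | ∃ (N : ℕ) (H : Fin (N + 1) → Set X),
    IsApproxPartition ξ f ε N H ∧ r = ⨆ n, sepRankSets ξ (H n) (H n)ᶜ})

/-- The finite partition rank `δ_fin(f)`. -/
def finPartRank {X : Type*} [TopologicalSpace X] (ξ : Ordinal.{0}) (f : X → ℝ) : Ordinal.{0} :=
  ⨆ ε : {ε : ℝ // 0 < ε}, finPartRankAt ξ f ε

/-- `θ ≲ θ'` : for every `1 ≤ η < ω₁`, if `θ' ≤ ω ^ η` then `θ ≤ ω ^ η`. -/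
def EssLE (θ θ' : Ordinal.{0}) : Prop :=
  ∀ η : Ordinal.{0}, 1 ≤ η → η < ω₁ → θ' ≤ ω ^ η → θ ≤ ω ^ η

/-- `θ ≈ θ'`. -/
def EssEq (θ θ' : Ordinal.{0}) : Prop := EssLE θ θ' ∧ EssLE θ' θ

end BaireRank

end

/-! A transfinite difference of length `L` is the set where a rank function `h : X → Iio L` with
`Π⁰_ξ` superlevel sets takes even values (`IsRanked`). The core is `IsRanked.boolean`: for `L = ω ^
η` with `1 ≤ η`, these sets form a Boolean algebra. Two ranks combine through their natural sum,
which is strictly monotone and stays below `ω ^ η`; upper sets of pairs of ordinals are finite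
unions of cones, so the superlevel sets remain `Π⁰_ξ`.

If `α_ξ(f) ≤ ω ^ η`, separators between consecutive levels of a fine finite grid can be disjointed
into an approximating partition of the same rank. Conversely, the pieces of a partition whose value
lies below the midpoint of `p` and `q` unite to a separator.

Countability of `α_ξ(f)` is Hausdorff's theorem: the two level sets are disjoint and `Π⁰_{ξ+1}`,
become `Gδ` in a finer Polish topology with `Σ⁰_ξ` open sets, and Baire category makes the iterated
derivative vanish at a countable stage. -/

namespace BaireRank

/-! ### Borel classes and level sets of Baire functions -/

section Borel

variable {X : Type*} [TopologicalSpace X]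

theorem IsSigma0.one_le {ξ : Ordinal.{0}} {S : Set X} (h : IsSigma0 ξ S) : 1 ≤ ξ := by
  cases h with
  | of_isOpen hU => exact le_rfl
  | iUnion ν A h1 hlt hA hS => exact (h1 0).trans (hlt 0).le

theorem IsSigma0.isOpen {S : Set X} (h : IsSigma0 1 S) : IsOpen S := by
  generalize hξ : (1 : Ordinal.{0}) = ξ at h
  cases h with
  | of_isOpen hU => exact hU
  | iUnion ν A h1 hlt hA hS => exact absurd (hlt 0) (by rw [← hξ]; exact (h1 0).not_gt)

theorem IsSigma0.empty {ξ : Ordinal.{0}} (hξ : 1 ≤ ξ) : IsSigma0 ξ (∅ : Set X) := by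
  rcases hξ.eq_or_lt with rfl | h
  · exact .of_isOpen isOpen_empty
  · exact .iUnion (fun _ => 1) (fun _ => ∅) (fun _ => le_rfl) (fun _ => h)
      (fun _ => by rw [compl_empty]; exact .of_isOpen isOpen_univ) (by simp)

theorem IsSigma0.exists_iUnion {ξ : Ordinal.{0}} {S : Set X} (h : IsSigma0 ξ S) (hξ : 1 < ξ) :
    ∃ (ν : ℕ → Ordinal.{0}) (A : ℕ → Set X), (∀ n, 1 ≤ ν n) ∧ (∀ n, ν n < ξ) ∧
      (∀ n, IsSigma0 (ν n) (A n)ᶜ) ∧ S = ⋃ n, A n := by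
  cases h with
  | of_isOpen hU => exact absurd hξ (lt_irrefl _)
  | iUnion ν A h1 hlt hA hS => exact ⟨ν, A, h1, hlt, hA, hS⟩

theorem IsPi0.isSigma0 {ξ ζ : Ordinal.{0}} {S : Set X} (h : IsPi0 ξ S) (hlt : ξ < ζ) :
    IsSigma0 ζ S :=
  .iUnion (fun _ => ξ) (fun _ => S) (fun _ => IsSigma0.one_le h) (fun _ => hlt) (fun _ => h)
    (iUnion_const S).symm

theorem IsSigma0.iUnion_nat {ξ : Ordinal.{0}} (hξ : 1 ≤ ξ) {S : ℕ → Set X}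
    (h : ∀ n, IsSigma0 ξ (S n)) : IsSigma0 ξ (⋃ n, S n) := by
  rcases hξ.eq_or_lt with rfl | hlt
  · exact .of_isOpen (isOpen_iUnion fun n => (h n).isOpen)
  choose ν A h1 h2 h3 h4 using fun n => (h n).exists_iUnion hlt
  refine .iUnion (fun k => ν k.unpair.1 k.unpair.2) (fun k => A k.unpair.1 k.unpair.2)
    (fun _ => h1 _ _) (fun _ => h2 _ _) (fun _ => h3 _ _) ?_
  rw [iUnion_unpair A]
  exact iUnion_congr h4

theorem IsSigma0.iUnion_countable {ξ : Ordinal.{0}} (hξ : 1 ≤ ξ) {ι : Type*} [Countable ι]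
    {S : ι → Set X} (h : ∀ n, IsSigma0 ξ (S n)) : IsSigma0 ξ (⋃ n, S n) := by
  rcases isEmpty_or_nonempty ι with hι | hι
  · rw [iUnion_of_empty]; exact .empty hξ
  obtain ⟨g, hg⟩ := exists_surjective_nat ι
  rw [← hg.iUnion_comp]
  exact .iUnion_nat hξ fun n => h _

theorem IsSigma0.union {ξ : Ordinal.{0}} {S T : Set X} (hS : IsSigma0 ξ S) (hT : IsSigma0 ξ T) :
    IsSigma0 ξ (S ∪ T) := by
  rw [union_eq_iUnion]
  exact .iUnion_countable hS.one_le (by rintro (_ | _) <;> simpa)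

theorem IsPi0.iInter_countable {ξ : Ordinal.{0}} (hξ : 1 ≤ ξ) {ι : Type*} [Countable ι]
    {S : ι → Set X} (h : ∀ n, IsPi0 ξ (S n)) : IsPi0 ξ (⋂ n, S n) := by
  rw [IsPi0, compl_iInter]; exact .iUnion_countable hξ h

theorem IsPi0.inter {ξ : Ordinal.{0}} {S T : Set X} (hS : IsPi0 ξ S) (hT : IsPi0 ξ T) :
    IsPi0 ξ (S ∩ T) := by
  rw [IsPi0, compl_inter]; exact IsSigma0.union hS hT

variable [PolishSpace X]

theorem exists_iUnion_isClosed_of_isOpen {U : Set X} (hU : IsOpen U) :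
    ∃ F : ℕ → Set X, (∀ n, IsClosed (F n)) ∧ U = ⋃ n, F n := by
  let := TopologicalSpace.upgradeIsCompletelyMetrizable X
  obtain ⟨F, hF, -, hU, -⟩ := hU.exists_iUnion_isClosed
  exact ⟨F, hF, hU.symm⟩

/-- Only open sets need an argument: they are countable unions of closed sets. A defining union at a
higher level serves unchanged for every larger class. -/
theorem IsSigma0.mono {ξ ζ : Ordinal.{0}} {S : Set X} (h : IsSigma0 ξ S) (hξ : ξ ≤ ζ) :
    IsSigma0 ζ S := by
  rcases hξ.eq_or_lt with rfl | hlt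
  · exact h
  cases h with
  | of_isOpen hU =>
    obtain ⟨F, hF, rfl⟩ := exists_iUnion_isClosed_of_isOpen hU
    exact .iUnion (fun _ => 1) F (fun _ => le_rfl) (fun _ => hlt)
      (fun n => .of_isOpen (hF n).isOpen_compl) rfl
  | iUnion ν A h1 hlt' hA hS => exact .iUnion ν A h1 (fun n => (hlt' n).trans hlt) hA hS

theorem IsSigma0.inter {ξ : Ordinal.{0}} {S T : Set X} (hS : IsSigma0 ξ S) (hT : IsSigma0 ξ T) :
    IsSigma0 ξ (S ∩ T) := by
  rcases hS.one_le.eq_or_lt with rfl | hlt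
  · exact .of_isOpen (hS.isOpen.inter hT.isOpen)
  obtain ⟨ν, A, h1, h2, h3, rfl⟩ := hS.exists_iUnion hlt
  obtain ⟨μ, B, k1, k2, k3, rfl⟩ := hT.exists_iUnion hlt
  refine .iUnion (fun k => max (ν k.unpair.1) (μ k.unpair.2))
    (fun k => A k.unpair.1 ∩ B k.unpair.2) (fun _ => le_max_of_le_left (h1 _))
    (fun _ => max_lt (h2 _) (k2 _)) (fun n => ?_) ?_
  · rw [compl_inter]
    exact ((h3 _).mono (le_max_left _ _)).union ((k3 _).mono (le_max_right _ _))
  · rw [iUnion_unpair fun i j => A i ∩ B j]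
    simp_rw [iUnion_inter, inter_iUnion]

theorem IsSigma0.univ {ξ : Ordinal.{0}} (hξ : 1 ≤ ξ) : IsSigma0 ξ (univ : Set X) :=
  (IsSigma0.of_isOpen isOpen_univ).mono hξ

theorem IsSigma0.sInter_finite {ξ : Ordinal.{0}} (hξ : 1 ≤ ξ) {𝒮 : Set (Set X)} (hfin : 𝒮.Finite)
    (h : ∀ S ∈ 𝒮, IsSigma0 ξ S) : IsSigma0 ξ (⋂₀ 𝒮) := by
  induction 𝒮, hfin using Set.Finite.induction_on with
  | empty => rw [sInter_empty]; exact .univ hξ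
  | insert _ _ ih =>
    rw [sInter_insert]
    exact (h _ (mem_insert _ _)).inter (ih fun S hS => h S (mem_insert_of_mem _ hS))

theorem IsPi0.biUnion_finite {ξ : Ordinal.{0}} (hξ : 1 ≤ ξ) {ι : Type*} {s : Set ι}
    (hfin : s.Finite) {S : ι → Set X} (h : ∀ n ∈ s, IsPi0 ξ (S n)) : IsPi0 ξ (⋃ n ∈ s, S n) := by
  rw [IsPi0, compl_iUnion₂, ← sInter_image]
  exact .sInter_finite hξ (hfin.image _) (by rintro _ ⟨n, hn, rfl⟩; exact h n hn)

/-- Strict sub- and superlevel sets of functions of Baire class `ξ` are `Σ⁰_{ξ+1}`. -/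
theorem IsBaireClass.isSigma0 {ξ : Ordinal.{0}} {f : X → ℝ} (hf : IsBaireClass ξ f) :
    ∀ p : ℝ, IsSigma0 (ξ + 1) {x | p < f x} ∧ IsSigma0 (ξ + 1) {x | f x < p} := by
  induction hf with
  | of_continuous hf =>
    intro p
    rw [zero_add]
    exact ⟨.of_isOpen (isOpen_lt continuous_const hf), .of_isOpen (isOpen_lt hf continuous_const)⟩
  | @of_tendsto ξ f ν g hlt hg hlim ih =>
    intro p
    have hξ : 1 ≤ ξ := Order.one_le_iff_pos.2 (pos_of_gt (hlt 0))
    have hle : ∀ n, ν n + 1 ≤ ξ := fun n => Order.add_one_le_of_lt (hlt n)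
    -- A strict inequality is lost in the limit; the rational `r` strictly between keeps it and
    -- leaves only `≤` under the intersection.
    have h1 : {x | p < f x} =
        ⋃ r : {r : ℚ // p < r}, ⋃ N : ℕ, ⋂ n : {n // N ≤ n}, {x | (r : ℝ) ≤ g n x} := by
      ext x
      simp only [mem_ofPred_eq, mem_iUnion, mem_iInter, Subtype.exists, Subtype.forall]
      constructor
      · intro hx
        obtain ⟨r, hr1, hr2⟩ := exists_rat_btwn hx
        obtain ⟨N, hN⟩ := eventually_atTop.1 ((hlim x).eventually_const_le hr2)
        exact ⟨r, hr1, N, hN⟩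
      · rintro ⟨r, hr, N, hN⟩
        exact hr.trans_le (ge_of_tendsto (hlim x) (eventually_atTop.2 ⟨N, hN⟩))
    have h2 : {x | f x < p} =
        ⋃ r : {r : ℚ // (r : ℝ) < p}, ⋃ N : ℕ, ⋂ n : {n // N ≤ n}, {x | g n x ≤ (r : ℝ)} := by
      ext x
      simp only [mem_ofPred_eq, mem_iUnion, mem_iInter, Subtype.exists, Subtype.forall]
      constructor
      · intro hx
        obtain ⟨r, hr1, hr2⟩ := exists_rat_btwn hx
        obtain ⟨N, hN⟩ := eventually_atTop.1 ((hlim x).eventually_le_const hr1)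
        exact ⟨r, hr2, N, hN⟩
      · rintro ⟨r, hr, N, hN⟩
        exact (le_of_tendsto (hlim x) (eventually_atTop.2 ⟨N, hN⟩)).trans_lt hr
    have hlt' : ξ < ξ + 1 := Order.lt_add_one_iff.2 le_rfl
    have h3 : ∀ n (r : ℝ), IsPi0 ξ {x | r ≤ g n x} := fun n r => by
      have := (ih n r).2.mono (hle n)
      rwa [IsPi0, show {x | r ≤ g n x}ᶜ = {x | g n x < r} by ext; simp]
    have h4 : ∀ n (r : ℝ), IsPi0 ξ {x | g n x ≤ r} := fun n r => by
      have := (ih n r).1.mono (hle n)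
      rwa [IsPi0, show {x | g n x ≤ r}ᶜ = {x | r < g n x} by ext; simp]
    rw [h1, h2]
    refine ⟨.iUnion_countable (hξ.trans hlt'.le) fun r => .iUnion_countable (hξ.trans hlt'.le)
      fun N => (IsPi0.iInter_countable hξ fun n => h3 _ _).isSigma0 hlt',
      .iUnion_countable (hξ.trans hlt'.le) fun r => .iUnion_countable (hξ.trans hlt'.le)
      fun N => (IsPi0.iInter_countable hξ fun n => h4 _ _).isSigma0 hlt'⟩

end Borel

/-! ### Natural sums and upper sets of pairs of ordinals -/

section NaturalSum

/-- The natural (Hessenberg) sum: the least operation strictly monotone in both arguments. -/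
noncomputable def natSum (a b : Ordinal.{0}) : Ordinal.{0} :=
  max (⨆ x : Iio a, Order.succ (natSum x.1 b)) (⨆ x : Iio b, Order.succ (natSum a x.1))
termination_by (a, b)
decreasing_by
  · exact Prod.Lex.left _ _ x.2
  · exact Prod.Lex.right _ x.2

theorem natSum_lt_left {a a' : Ordinal.{0}} (b : Ordinal.{0}) (h : a < a') :
    natSum a b < natSum a' b := by
  rw [natSum.eq_def a' b]
  exact lt_max_of_lt_left ((Order.lt_succ _).trans_le
    (Ordinal.le_iSup (fun x : Iio a' => Order.succ (natSum x.1 b)) ⟨a, h⟩))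

theorem natSum_lt_right (a : Ordinal.{0}) {b b' : Ordinal.{0}} (h : b < b') :
    natSum a b < natSum a b' := by
  rw [natSum.eq_def a b']
  exact lt_max_of_lt_right ((Order.lt_succ _).trans_le
    (Ordinal.le_iSup (fun x : Iio b' => Order.succ (natSum a x.1)) ⟨b, h⟩))

theorem natSum_le {a b c : Ordinal.{0}} (h1 : ∀ x < a, natSum x b < c)
    (h2 : ∀ x < b, natSum a x < c) : natSum a b ≤ c := by
  rw [natSum.eq_def]
  exact max_le (Ordinal.iSup_le fun x => Order.succ_le_of_lt (h1 x x.2))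
    (Ordinal.iSup_le fun x => Order.succ_le_of_lt (h2 x x.2))

theorem natSum_lt_of_lt {p q : Ordinal.{0} × Ordinal.{0}} (h : p < q) :
    natSum p.1 p.2 < natSum q.1 q.2 := by
  have hle : ∀ b {a a' : Ordinal.{0}}, a ≤ a' → natSum a b ≤ natSum a' b := fun b a a' h =>
    h.eq_or_lt.elim (fun h => h ▸ le_rfl) fun h => (natSum_lt_left b h).le
  rcases Prod.lt_iff.1 h with ⟨h1, h2⟩ | ⟨h1, h2⟩
  · rcases h2.eq_or_lt with h2 | h2
    · rw [h2]; exact natSum_lt_left _ h1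
    · exact (natSum_lt_left _ h1).trans (natSum_lt_right _ h2)
  · exact (natSum_lt_right _ h2).trans_le (hle _ h1)

theorem natSum_natCast_le (n m : ℕ) : natSum n m ≤ ((n + m : ℕ) : Ordinal.{0}) := by
  induction n using Nat.strong_induction_on generalizing m with | _ n ihn =>
  induction m using Nat.strong_induction_on with | _ m ihm =>
  refine natSum_le (fun x hx => ?_) fun x hx => ?_
  · obtain ⟨k, rfl⟩ := Ordinal.lt_omega0.1 (hx.trans (Ordinal.natCast_lt_omega0 n))
    have hk : k < n := by exact_mod_cast hx
    exact (ihn k hk m).trans_lt (by exact_mod_cast Nat.add_lt_add_right hk m)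
  · obtain ⟨k, rfl⟩ := Ordinal.lt_omega0.1 (hx.trans (Ordinal.natCast_lt_omega0 m))
    have hk : k < m := by exact_mod_cast hx
    exact (ihm k hk).trans_lt (by exact_mod_cast Nat.add_lt_add_left hk n)

theorem lt_div_or_mod_lt {c x a : Ordinal.{0}} (h : x < a) :
    x / c < a / c ∨ x / c = a / c ∧ x % c < a % c := by
  rcases lt_trichotomy (x / c) (a / c) with h' | h' | h'
  · exact .inl h'
  · refine .inr ⟨h', ?_⟩
    rw [← Ordinal.div_add_mod x c, ← Ordinal.div_add_mod a c, h'] at h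
    exact lt_of_add_lt_add_left h
  · exact absurd (Ordinal.div_le_left h.le c) h'.not_ge

/-- The right-hand side is strictly increasing in each argument: a larger quotient outweighs any
remainder term, which is below `c` by `hc`, and with equal quotients the remainder grows. The
natural sum is the least such operation. -/
theorem natSum_le_mul_add {c : Ordinal.{0}} (hc : ∀ a < c, ∀ b < c, natSum a b < c) (h0 : 0 < c)
    (a b : Ordinal.{0}) :
    natSum a b ≤ c * natSum (a / c) (b / c) + natSum (a % c) (b % c) := by
  have hmod : ∀ a b, natSum (a % c) (b % c) < c := fun a b =>
    hc _ (Ordinal.mod_lt _ h0.ne') _ (Ordinal.mod_lt _ h0.ne')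
  have key : ∀ {s t : Ordinal.{0}} (u : Ordinal.{0}) {r : Ordinal.{0}}, r < c → s < t →
      c * s + r < c * t + u := fun {s t} u {r} hr hst => calc
    c * s + r < c * s + c := (add_lt_add_iff_left _).2 hr
    _ = c * Order.succ s := (Ordinal.mul_succ _ _).symm
    _ ≤ c * t := mul_le_mul_right (Order.succ_le_of_lt hst) c
    _ ≤ c * t + u := le_self_add
  induction a using WellFoundedLT.induction generalizing b with | _ a iha =>
  induction b using WellFoundedLT.induction with | _ b ihb =>
  refine natSum_le (fun x hx => (iha x hx b).trans_lt ?_) fun x hx => (ihb x hx).trans_lt ?_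
  · rcases lt_div_or_mod_lt (c := c) hx with h | ⟨h, h'⟩
    · exact key _ (hmod _ _) (natSum_lt_left _ h)
    · rw [h]; exact (add_lt_add_iff_left _).2 (natSum_lt_left _ h')
  · rcases lt_div_or_mod_lt (c := c) hx with h | ⟨h, h'⟩
    · exact key _ (hmod _ _) (natSum_lt_right _ h)
    · rw [h]; exact (add_lt_add_iff_left _).2 (natSum_lt_right _ h')

/-- At a successor exponent the quotients by `ω ^ η` are finite, so their natural sum is finite too.
-/
theorem natSum_lt_omega0_opow (η : Ordinal.{0}) :
    ∀ a < ω ^ η, ∀ b < ω ^ η, natSum a b < ω ^ η := by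
  induction η using Ordinal.limitRecOn with
  | zero =>
    intro a ha b hb
    rw [Ordinal.opow_zero, Order.lt_one_iff] at ha hb
    rw [Ordinal.opow_zero, Order.lt_one_iff, ha, hb]
    simpa using natSum_natCast_le 0 0
  | add_one η ih =>
    intro a ha b hb
    have h0 : 0 < ω ^ η := Ordinal.opow_pos _ Ordinal.omega0_pos
    rw [Ordinal.opow_add, Ordinal.opow_one] at ha hb ⊢
    obtain ⟨n, hn⟩ := Ordinal.lt_omega0.1 ((Ordinal.lt_mul_iff_div_lt h0.ne').1 ha)
    obtain ⟨m, hm⟩ := Ordinal.lt_omega0.1 ((Ordinal.lt_mul_iff_div_lt h0.ne').1 hb)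
    calc natSum a b ≤ _ := natSum_le_mul_add ih h0 a b
      _ < ω ^ η * natSum (a / ω ^ η) (b / ω ^ η) + ω ^ η := (add_lt_add_iff_left _).2
        (ih _ (Ordinal.mod_lt _ h0.ne') _ (Ordinal.mod_lt _ h0.ne'))
      _ = ω ^ η * Order.succ (natSum (a / ω ^ η) (b / ω ^ η)) := (Ordinal.mul_succ _ _).symm
      _ ≤ ω ^ η * ω := by
        refine mul_le_mul_right (Order.succ_le_of_lt ?_) _
        rw [hn, hm]
        exact (natSum_natCast_le n m).trans_lt (Ordinal.natCast_lt_omega0 _)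
  | limit η hη ih =>
    intro a ha b hb
    obtain ⟨δ, hδ, ha⟩ := (Ordinal.lt_opow_of_isSuccLimit Ordinal.omega0_ne_zero hη).1 ha
    obtain ⟨ε, hε, hb⟩ := (Ordinal.lt_opow_of_isSuccLimit Ordinal.omega0_ne_zero hη).1 hb
    have hmax : max δ ε < η := max_lt hδ hε
    refine (ih _ hmax a (ha.trans_le ?_) b (hb.trans_le ?_)).trans_le
      (Ordinal.opow_le_opow_right Ordinal.omega0_pos hmax.le)
    · exact Ordinal.opow_le_opow_right Ordinal.omega0_pos (le_max_left _ _)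
    · exact Ordinal.opow_le_opow_right Ordinal.omega0_pos (le_max_right _ _)

/-- The minimal elements form an antichain, which is finite because a product of two well-orders is
a well-quasi-order. -/
theorem exists_finite_upperClosure_eq {U : Set (Ordinal.{0} × Ordinal.{0})} (hU : IsUpperSet U) :
    ∃ s : Set (Ordinal.{0} × Ordinal.{0}), s.Finite ∧ ∀ q, q ∈ U ↔ ∃ p ∈ s, p ≤ q := by
  refine ⟨{p | Minimal (· ∈ U) p}, (setOfPred_minimal_antichain (· ∈ U)).finite_of_wellQuasiOrdered
    wellQuasiOrdered_le, fun q => ⟨fun hq => ?_, fun ⟨p, hp, hpq⟩ => hU hpq hp.prop⟩⟩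
  obtain ⟨p, hpq, hp⟩ := exists_minimal_le_of_wellFoundedLT (· ∈ U) q hq
  exact ⟨p, hp, hpq⟩

end NaturalSum

/-! ### Transfinite differences as parity sets of rank functions -/

section Ranked

theorem not_isEvenOrd_two_mul_add_one (θ : Ordinal.{0}) : ¬ IsEvenOrd (2 * θ + 1) := by
  rintro ⟨η, h⟩
  have h1 : (2 * θ + 1) % 2 = 1 := by
    rw [Ordinal.mul_add_mod_self, Ordinal.mod_eq_of_lt one_lt_two]
  rw [h, Ordinal.mul_mod] at h1
  exact zero_ne_one h1

theorem eq_two_mul_or_two_mul_add_one (γ : Ordinal.{0}) :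
    ∃ δ : Ordinal.{0}, γ = 2 * δ ∨ γ = 2 * δ + 1 := by
  refine ⟨γ / 2, ?_⟩
  have h : γ % 2 < 2 := Ordinal.mod_lt _ two_ne_zero
  rw [← one_add_one_eq_two, Order.lt_add_one_iff, Order.le_one_iff] at h
  have h2 := Ordinal.div_add_mod γ 2
  rw [one_add_one_eq_two] at h
  rcases h with h | h <;> rw [h] at h2
  · rw [add_zero] at h2; exact .inl h2.symm
  · exact .inr h2.symm

theorem omega0_opow_lt_omega_one {η : Ordinal.{0}} (hη : η < ω₁) : ω ^ η < ω₁ :=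
  Ordinal.isPrincipal_opow_omega 1 Ordinal.omega0_lt_omega_one hη

theorem exists_le_omega0_opow {θ : Ordinal.{0}} (hθ : θ < ω₁) :
    ∃ η, 1 ≤ η ∧ η < ω₁ ∧ θ ≤ ω ^ η :=
  -- The summand `1` only secures a positive exponent.
  ⟨1 + θ, le_self_add, Ordinal.isPrincipal_add_omega 1
      (Ordinal.one_lt_omega0.trans Ordinal.omega0_lt_omega_one) hθ,
    le_add_self.trans (Ordinal.right_le_opow _ Ordinal.one_lt_omega0)⟩

theorem countable_Iio_of_lt_omega_one {L : Ordinal.{0}} (hL : L < ω₁) : Countable (Iio L) := by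
  rw [← Cardinal.mk_le_aleph0_iff, Cardinal.mk_Iio_ordinal, Cardinal.lift_le_aleph0]
  rwa [← Cardinal.ord_aleph, Cardinal.lt_ord, ← Cardinal.succ_aleph0, Order.lt_succ_iff] at hL

variable {X : Type*} [TopologicalSpace X]

/-- `A` is the set where `h` is even, for a function `h` into the ordinals below `L` whose
superlevel sets are `Π⁰_ξ`. This is the transfinite difference of the superlevel sets of `h`. -/
def IsRanked (ξ L : Ordinal.{0}) (A : Set X) : Prop :=
  ∃ h : X → Ordinal.{0}, (∀ x, h x < L) ∧ (∀ γ, IsPi0 ξ {x | γ ≤ h x}) ∧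
    ∀ x, x ∈ A ↔ IsEvenOrd (h x)

theorem IsRanked.mono {ξ L L' : Ordinal.{0}} {A : Set X} (hA : IsRanked ξ L A) (hL : L ≤ L') :
    IsRanked ξ L' A :=
  let ⟨h, h1, h2⟩ := hA
  ⟨h, fun x => (h1 x).trans_le hL, h2⟩

/-- By continuity a point first leaves the sequence at a successor stage `η + 1`, never at a limit,
so there is a last index `η` at which it is present. -/
theorem IsDiffSeq.exists_rank {ξ L : Ordinal.{0}} {F : Ordinal.{0} → Set X}
    (hF : IsDiffSeq ξ L F) : ∃ h : X → Ordinal.{0}, ∀ x γ, x ∈ F γ ↔ γ ≤ h x := by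
  have hne : ∀ x, {η | x ∉ F (η + 1)}.Nonempty := fun x =>
    ⟨L, by simp [hF.eq_empty (L + 1) le_self_add]⟩
  refine ⟨fun x => sInf {η | x ∉ F (η + 1)}, fun x γ => ?_⟩
  have hmem : x ∉ F (sInf {η | x ∉ F (η + 1)} + 1) := csInf_mem (hne x)
  have hlt : ∀ δ < sInf {η | x ∉ F (η + 1)}, x ∈ F (δ + 1) := fun δ hδ => by
    by_contra hx
    exact notMem_of_lt_csInf' hδ hx
  constructor
  · intro hx
    by_contra! h
    exact hmem (hF.antitone _ _ (Order.add_one_le_of_lt h) hx)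
  · intro h
    rcases Ordinal.zero_or_succ_or_isSuccLimit γ with rfl | ⟨δ, rfl⟩ | hγ
    · rw [hF.zero]; trivial
    · exact hlt δ ((Order.lt_succ δ).trans_le h)
    · have hθ : ∀ θ < γ, x ∈ F θ := fun θ hθ =>
        hF.antitone _ _ le_self_add (hlt θ (hθ.trans_le h))
      rcases lt_or_ge γ L with hγL | hγL
      · rw [hF.continuous γ hγL hγ]
        exact mem_iInter₂.2 hθ
      exfalso
      rcases hγL.eq_or_lt with rfl | hγL
      · have := hF.iInter_eq_empty hγ
        exact (this ▸ mem_iInter₂.2 hθ : x ∈ (∅ : Set X))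
      · have := hθ L hγL
        rwa [hF.eq_empty L le_rfl] at this

theorem IsDiffSeq.isRanked {ξ L : Ordinal.{0}} {F : Ordinal.{0} → Set X}
    (hU : IsSigma0 ξ (univ : Set X)) (hF : IsDiffSeq ξ L F) :
    IsRanked ξ L (transDiff L F) := by
  obtain ⟨h, hh⟩ := hF.exists_rank
  have hL : ∀ x, h x < L := fun x => by
    by_contra! hx
    rw [← hh, hF.eq_empty L le_rfl] at hx
    exact hx
  refine ⟨h, hL, fun γ => ?_, fun x => ?_⟩
  · have : {x | γ ≤ h x} = F γ := by ext x; exact (hh x γ).symm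
    rw [this]
    rcases lt_or_ge γ L with hγ | hγ
    · exact hF.isPi0 γ hγ
    · rw [hF.eq_empty γ hγ, IsPi0, compl_empty]; exact hU
  · constructor
    · rintro ⟨η, -, he, h1, h2⟩
      rw [hh] at h1 h2
      rwa [← h1.antisymm (Order.lt_add_one_iff.1 (not_le.1 h2))]
    · intro he
      refine ⟨h x, hL x, he, (hh x _).2 le_rfl, ?_⟩
      rw [hh]
      exact (Order.lt_add_one_iff.2 le_rfl).not_ge

theorem IsRanked.exists_isDiffSeq {ξ L : Ordinal.{0}} {A : Set X} (hA : IsRanked ξ L A) :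
    ∃ F, IsDiffSeq ξ L F ∧ transDiff L F = A := by
  obtain ⟨h, hL, hpi, hA⟩ := hA
  refine ⟨fun γ => {x | γ ≤ h x}, ⟨fun η _ => hpi η, ?_, fun η θ hle x hx => hle.trans hx,
    fun η _ hη => ?_, fun hlim => ?_, fun η hη => ?_⟩, ?_⟩
  · ext x; simp
  · ext x
    simp only [mem_ofPred_eq, mem_iInter]
    exact ⟨fun hx θ hθ => hθ.le.trans hx, fun hx => hη.isSuccPrelimit.le_iff_forall_le.2 hx⟩
  · refine eq_empty_of_forall_notMem fun x hx => ?_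
    rw [mem_iInter₂] at hx
    exact (hL x).not_ge (hlim.isSuccPrelimit.le_iff_forall_le.2 hx)
  · exact eq_empty_of_forall_notMem fun x hx => ((hL x).trans_le hη).not_ge hx
  · ext x
    rw [hA]
    constructor
    · rintro ⟨η, -, he, h1, h2⟩
      have h3 : h x = η := (Order.lt_add_one_iff.1 (not_le.1 h2)).antisymm h1
      rwa [h3]
    · exact fun he => ⟨h x, hL x, he, le_refl (h x),
        fun h1 : h x + 1 ≤ h x => (Order.lt_add_one_iff.2 le_rfl).not_ge h1⟩

/-- A criterion for `IsRanked` in which the parity of the rank is traded for an arbitrary set. -/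
theorem isRanked_of_rank {ξ L : Ordinal.{0}} {C : Set X} (d : X → Ordinal.{0})
    (hL : ∀ x, 2 * d x + 1 < L) (h1 : ∀ γ, IsPi0 ξ {x | γ ≤ d x})
    (h2 : ∀ γ, IsPi0 ξ {x | γ < d x ∨ γ = d x ∧ x ∉ C}) : IsRanked ξ L C := by
  classical
  have hpos : (0 : Ordinal.{0}) < 2 := two_pos
  have hlt : ∀ {a b : Ordinal.{0}}, a < b → 2 * a + 1 < 2 * b := fun {a b} h => by
    have h3 : 2 * (a + 1) ≤ 2 * b := mul_le_mul_right (Order.add_one_le_of_lt h) 2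
    rw [mul_add_one] at h3
    exact ((add_lt_add_iff_left _).2 one_lt_two).trans_le h3
  -- The superlevel set at `2 * δ` is the set in `h1`, and at `2 * δ + 1` the set in `h2`.
  refine ⟨fun x => if x ∈ C then 2 * d x else 2 * d x + 1, fun x => ?_, fun γ => ?_, fun x => ?_⟩
  · dsimp only
    split_ifs
    · exact (Order.lt_add_one_iff.2 le_rfl).trans (hL x)
    · exact hL x
  · obtain ⟨δ, rfl | rfl⟩ := eq_two_mul_or_two_mul_add_one γ
    · convert h1 δ using 3 with x
      dsimp only
      constructor
      · intro h
        by_contra! hlt'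
        have h3 := hlt hlt'
        split_ifs at h
        · exact (h.trans_lt ((Order.lt_add_one_iff.2 le_rfl).trans h3)).false
        · exact (h.trans_lt h3).false
      · intro h
        have h3 : 2 * δ ≤ 2 * d x := mul_le_mul_right h 2
        split_ifs
        · exact h3
        · exact h3.trans le_self_add
    · convert h2 δ using 3 with x
      dsimp only
      constructor
      · intro h
        rcases lt_trichotomy δ (d x) with h3 | rfl | h3
        · exact .inl h3
        · refine .inr ⟨rfl, fun hC => ?_⟩
          rw [if_pos hC] at h
          exact (Order.lt_add_one_iff.2 le_rfl).not_ge h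
        · have h4 := hlt h3
          split_ifs at h
          · exact absurd (h.trans_lt ((Order.lt_add_one_iff.2 le_rfl).trans h4))
              (le_self_add.not_gt)
          · exact absurd (h.trans_lt h4) (le_self_add.not_gt)
      · rintro (h | ⟨rfl, h⟩)
        · have h3 := (hlt h).le
          split_ifs
          · exact h3
          · exact h3.trans le_self_add
        · rw [if_neg h]
  · dsimp only
    split_ifs with h
    · exact iff_of_true h ⟨_, rfl⟩
    · exact iff_of_false h (not_isEvenOrd_two_mul_add_one _)

/-- A left factor `2` is absorbed because `2 * ω = ω`; for `η = 0` this fails. -/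
theorem two_mul_add_one_lt_omega0_opow {η a : Ordinal.{0}} (hη : 1 ≤ η) (ha : a < ω ^ η) :
    2 * a + 1 < ω ^ η := by
  have h2 : 2 * ω ^ η = ω ^ η := by
    obtain ⟨ζ, rfl⟩ := exists_add_of_le hη
    rw [Ordinal.opow_add, Ordinal.opow_one, ← mul_assoc, Ordinal.mul_omega0 two_pos]
    exact_mod_cast Ordinal.natCast_lt_omega0 2
  have h3 : 2 * (a + 1) ≤ 2 * ω ^ η := mul_le_mul_right (Order.add_one_le_of_lt ha) 2
  rw [mul_add_one, h2] at h3
  exact ((add_lt_add_iff_left _).2 one_lt_two).trans_le h3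

theorem sepRankSets_le {ξ L : Ordinal.{0}} (hL : L < ω₁) {A B C : Set X}
    (hC : IsRanked ξ L C) (hA : A ⊆ C) (hB : C ⊆ Bᶜ) : sepRankSets ξ A B ≤ L := by
  obtain ⟨F, hF, rfl⟩ := hC.exists_isDiffSeq
  exact csInf_le' (.inr ⟨hL, F, hF, hA, hB⟩)

variable [PolishSpace X]

theorem isPi0_of_isUpperSet {ξ : Ordinal.{0}} (hξ : 1 ≤ ξ) {h k : X → Ordinal.{0}}
    (hh : ∀ γ, IsPi0 ξ {x | γ ≤ h x}) (hk : ∀ γ, IsPi0 ξ {x | γ ≤ k x})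
    {U : Set (Ordinal.{0} × Ordinal.{0})} (hU : IsUpperSet U) :
    IsPi0 ξ {x | (h x, k x) ∈ U} := by
  obtain ⟨s, hs, hsU⟩ := exists_finite_upperClosure_eq hU
  have : {x | (h x, k x) ∈ U} = ⋃ p ∈ s, {x | p.1 ≤ h x} ∩ {x | p.2 ≤ k x} := by
    ext x
    simp only [mem_ofPred_eq, hsU, mem_iUnion, mem_inter_iff, exists_prop, Prod.le_def]
  rw [this]
  exact .biUnion_finite hξ hs fun p _ => (hh _).inter (hk _)

/-- Boolean combinations of sets of rank at most `ω ^ η` have rank at most `ω ^ η`. -/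
theorem IsRanked.boolean {ξ η : Ordinal.{0}} (hξ : 1 ≤ ξ) (hη : 1 ≤ η) {A B C : Set X}
    (hA : IsRanked ξ (ω ^ η) A) (hB : IsRanked ξ (ω ^ η) B) (P : Prop → Prop → Prop)
    (hC : ∀ x, x ∈ C ↔ P (x ∈ A) (x ∈ B)) : IsRanked ξ (ω ^ η) C := by
  obtain ⟨h, hL, hpi, hA⟩ := hA
  obtain ⟨k, kL, kpi, hB⟩ := hB
  have hle : ∀ {p q : Ordinal.{0} × Ordinal.{0}}, p ≤ q → natSum p.1 p.2 ≤ natSum q.1 q.2 :=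
    fun hpq => hpq.eq_or_lt.elim (fun h => h ▸ le_rfl) fun h => (natSum_lt_of_lt h).le
  refine isRanked_of_rank (fun x => natSum (h x) (k x)) (fun x =>
    two_mul_add_one_lt_omega0_opow hη (natSum_lt_omega0_opow η _ (hL x) _ (kL x)))
    (fun γ => isPi0_of_isUpperSet hξ hpi kpi (U := {p | γ ≤ natSum p.1 p.2})
      fun p q hpq hp => le_trans hp (hle hpq)) fun γ => ?_
  -- Pairs with natural sum `γ` form an antichain, so any choice among them, together with
  -- everything of larger sum, is an upper set. This is why `P` may be arbitrary.
  have hU : IsUpperSet {p : Ordinal.{0} × Ordinal.{0} | γ < natSum p.1 p.2 ∨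
      γ = natSum p.1 p.2 ∧ ¬ P (IsEvenOrd p.1) (IsEvenOrd p.2)} := by
    intro p q hpq hp
    rcases hpq.eq_or_lt with rfl | hlt
    · exact hp
    · exact .inl ((hp.elim le_of_lt fun h => h.1.le).trans_lt (natSum_lt_of_lt hlt))
  convert isPi0_of_isUpperSet hξ hpi kpi hU using 3 with x
  rw [hC, hA, hB]
  rfl

theorem IsRanked.isDelta0 {ξ L : Ordinal.{0}} (hξ : 1 ≤ ξ) (hL : L < ω₁) {A : Set X}
    (hA : IsRanked ξ L A) : IsDelta0 (ξ + 1) A := by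
  obtain ⟨h, hL', hpi, hA⟩ := hA
  have hlt : ξ < ξ + 1 := Order.lt_add_one_iff.2 le_rfl
  have hcount := countable_Iio_of_lt_omega_one hL
  have key : ∀ Q : Ordinal.{0} → Prop, IsSigma0 (ξ + 1) {x | Q (h x)} := fun Q => by
    -- The set splits into countably many fibres of `h`, each a difference of two `Π⁰_ξ` sets.
    have : {x | Q (h x)} =
        ⋃ γ : {γ : Iio L // Q γ}, {x | γ.1.1 ≤ h x} ∩ {x | γ.1.1 + 1 ≤ h x}ᶜ := by
      ext x
      simp only [mem_ofPred_eq, mem_iUnion, mem_inter_iff, mem_compl_iff, not_le,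
        Order.lt_add_one_iff]
      constructor
      · exact fun hQ => ⟨⟨⟨h x, hL' x⟩, hQ⟩, le_rfl, le_rfl⟩
      · rintro ⟨⟨⟨γ, _⟩, hQ⟩, h1, h2⟩
        rwa [← le_antisymm h1 h2]
    rw [this]
    exact .iUnion_countable (hξ.trans hlt.le) fun γ =>
      ((hpi _).isSigma0 hlt).inter (IsSigma0.mono (hpi _) hlt.le)
  refine ⟨?_, ?_⟩
  · convert key IsEvenOrd using 1
    ext x
    exact hA x
  · rw [IsPi0]
    convert key (fun γ => ¬ IsEvenOrd γ) using 1
    ext x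
    exact not_congr (hA x)

theorem exists_isRanked_of_sepRankSets_le {ξ L : Ordinal.{0}} (hξ : 1 ≤ ξ) (hL : L < ω₁)
    {A B : Set X} (h : sepRankSets ξ A B ≤ L) : ∃ C, IsRanked ξ L C ∧ A ⊆ C ∧ C ⊆ Bᶜ := by
  rcases csInf_mem (insert_nonempty ω₁ {L : Ordinal.{0} | L < ω₁ ∧ ∃ F : Ordinal.{0} → Set X,
    IsDiffSeq ξ L F ∧ A ⊆ transDiff L F ∧ transDiff L F ⊆ Bᶜ}) with h1 | ⟨h1, F, hF, hA, hB⟩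
  · exact absurd (h.trans_lt hL) (h1.ge.not_gt)
  · exact ⟨_, (hF.isRanked (.univ hξ)).mono h, hA, hB⟩

end Ranked

/-! ### Finer Polish topologies -/

section Refinement

variable {X : Type*}

/-- An open set can be made closed by a finer Polish topology whose open sets are obtained by
glueing open sets along it. -/
theorem exists_polishSpace_isClosed (t : TopologicalSpace X) (ht : PolishSpace X) {s : Set X}
    (hs : IsOpen s) : ∃ t' : TopologicalSpace X, t' ≤ t ∧ @PolishSpace X t' ∧ IsClosed[t'] s ∧
      ∀ U, IsOpen[t'] U → ∃ V W, IsOpen[t] V ∧ IsOpen[t] W ∧ U = V ∩ s ∪ W ∩ sᶜ := by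
  classical
  -- The new topology is the disjoint sum of `s` and its complement, both Polish.
  have : PolishSpace s := hs.polishSpace
  have : PolishSpace (sᶜ : Set X) := hs.isClosed_compl.polishSpace
  let f : s ⊕ (sᶜ : Set X) ≃ X := Equiv.Set.sumCompl s
  have hle : TopologicalSpace.coinduced f instTopologicalSpaceSum ≤ t := by
    simp only [instTopologicalSpaceSum, coinduced_sup, coinduced_compose, sup_le_iff,
      ← continuous_iff_coinduced_le]
    exact ⟨continuous_subtype_val, continuous_subtype_val⟩
  refine ⟨.coinduced f instTopologicalSpaceSum, hle, ?_, ?_, fun U hU => ?_⟩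
  · rw [← f.induced_symm]
    exact f.symm.polishSpace_induced
  · rw [← @isOpen_compl_iff X s (.coinduced f instTopologicalSpaceSum), isOpen_coinduced,
      isOpen_sum_iff]
    simp [preimage_preimage, f]
  · rw [isOpen_coinduced, isOpen_sum_iff] at hU
    obtain ⟨V, hV, h1⟩ := isOpen_induced_iff.1 hU.1
    obtain ⟨W, hW, h2⟩ := isOpen_induced_iff.1 hU.2
    refine ⟨V, W, hV, hW, ?_⟩
    ext x
    by_cases hx : x ∈ s
    · have := Set.ext_iff.1 h1 ⟨x, hx⟩
      simp only [mem_preimage] at this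
      simpa [hx, f] using this.symm
    · have := Set.ext_iff.1 h2 ⟨x, hx⟩
      simp only [mem_preimage] at this
      simpa [hx, f] using this.symm

/-- `t'` is a Polish topology finer than `t` all of whose open sets are `Σ⁰_ξ` for `t`. -/
structure IsSigma0Refinement (t : TopologicalSpace X) (ξ : Ordinal.{0})
    (t' : TopologicalSpace X) : Prop where
  le : t' ≤ t
  polishSpace : @PolishSpace X t'
  isSigma0 : ∀ U, IsOpen[t'] U → @IsSigma0 X t ξ U

/-- A Polish topology is second countable, so each open set is a countable union of finite
intersections of generators. -/
theorem IsSigma0Refinement.of_generateFrom {t t' : TopologicalSpace X} (ht : @PolishSpace X t)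
    {ξ : Ordinal.{0}} (hξ : 1 ≤ ξ) {𝒢 : Set (Set X)} (hle : t' ≤ t) (hp : @PolishSpace X t')
    (hgen : t' = .generateFrom 𝒢) (h𝒢 : ∀ S ∈ 𝒢, @IsSigma0 X t ξ S) :
    IsSigma0Refinement t ξ t' := by
  refine ⟨hle, hp, fun U hU => ?_⟩
  have hb := @TopologicalSpace.isTopologicalBasis_of_subbasis X t' 𝒢 hgen
  obtain ⟨𝒮, h𝒮, rfl⟩ := hb.open_eq_sUnion hU
  obtain ⟨T, hTc, hT, hTU⟩ := @TopologicalSpace.isOpen_sUnion_countable X t'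
    inferInstance 𝒮 fun s hs => hb.isOpen (h𝒮 hs)
  rw [← hTU, sUnion_eq_iUnion]
  have := hTc.to_subtype
  refine @IsSigma0.iUnion_countable X t ξ hξ _ _ _ fun S => ?_
  obtain ⟨f, ⟨hf, hf𝒢⟩, hS⟩ := h𝒮 (hT S.2)
  rw [← hS]
  exact @IsSigma0.sInter_finite X t ht ξ hξ _ hf fun A hA => h𝒢 A (hf𝒢 hA)

/-- Countably many Polish refinements with `Σ⁰_ξ` open sets have a common such refinement. -/
theorem exists_isSigma0Refinement_forall_le (t : TopologicalSpace X) (ht : PolishSpace X)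
    {ξ : Ordinal.{0}} (hξ : 1 ≤ ξ) {m : ℕ → TopologicalSpace X}
    (hm : ∀ n, IsSigma0Refinement t ξ (m n)) :
    ∃ t', (∀ n, t' ≤ m n) ∧ IsSigma0Refinement t ξ t' := by
  -- Adjoining `t` itself gives the family the coarsest member that `PolishSpace.iInf` asks for.
  let k : Option ℕ → TopologicalSpace X := fun i => i.elim t m
  have hk : @PolishSpace X (⨅ i, k i) :=
    .iInf ⟨none, Option.forall.2 ⟨le_rfl, fun n => (hm n).le⟩⟩
      (Option.forall.2 ⟨ht, fun n => (hm n).polishSpace⟩)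
  refine ⟨⨅ i, k i, fun n => iInf_le k (some n), .of_generateFrom ht hξ (iInf_le k none) hk
    (generateFrom_iUnion_isOpen k).symm fun S hS => ?_⟩
  obtain ⟨i, hi⟩ := mem_iUnion.1 hS
  cases i with
  | none => exact @IsSigma0.mono X t ht _ _ _ (@IsSigma0.of_isOpen X t _ hi) hξ
  | some n => exact (hm n).isSigma0 S hi

/-- A `Σ⁰_ξ` set is open in a finer Polish topology all of whose open sets are `Σ⁰_ξ`. -/
theorem IsSigma0.exists_refinement_isOpen (t : TopologicalSpace X) (ht : PolishSpace X)
    {ξ : Ordinal.{0}} {S : Set X} (h : IsSigma0 ξ S) :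
    ∃ t', IsSigma0Refinement t ξ t' ∧ IsOpen[t'] S := by
  induction h with
  | of_isOpen hU => exact ⟨t, ⟨le_rfl, ht, fun _ => .of_isOpen⟩, hU⟩
  | @iUnion ξ S ν A h1 hlt hA hS ih =>
    have hξ : 1 ≤ ξ := (h1 0).trans (hlt 0).le
    choose k hk hko using ih
    -- The complement of `A n` is already open in `k n`; making it closed as well opens `A n`.
    -- Gluing along it stays within `Σ⁰_ξ` since `ν n < ξ`.
    choose m hm hmp hmc hmo using fun n =>
      exists_polishSpace_isClosed (k n) (hk n).polishSpace (hko n)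
    obtain ⟨t', ht', h2⟩ := exists_isSigma0Refinement_forall_le t ht hξ (m := m)
      fun n => ⟨(hm n).trans (hk n).le, hmp n, fun U hU => by
        obtain ⟨V, W, hV, hW, rfl⟩ := hmo n U hU
        have hle := (hlt n).le
        exact ((((hk n).isSigma0 V hV).mono hle).inter ((hA n).mono hle)).union
          ((((hk n).isSigma0 W hW).mono hle).inter
            (IsPi0.isSigma0 (by rw [IsPi0, compl_compl]; exact hA n) (hlt n)))⟩
    refine ⟨t', h2, ?_⟩
    rw [hS]
    refine @isOpen_iUnion X ℕ t' _ fun n => ht' n _ ?_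
    rw [← compl_compl (A n)]
    exact (@isOpen_compl_iff X _ (m n)).2 (hmc n)

/-- Two `Π⁰_{ξ+1}` sets are `Gδ` in a finer Polish topology all of whose open sets are `Σ⁰_ξ`. -/
theorem exists_refinement_isGδ (t : TopologicalSpace X) (ht : PolishSpace X) {ξ : Ordinal.{0}}
    (hξ : 1 ≤ ξ) {A B : Set X} (hA : IsPi0 (ξ + 1) A) (hB : IsPi0 (ξ + 1) B) :
    ∃ t', IsSigma0Refinement t ξ t' ∧ @IsGδ X t' A ∧ @IsGδ X t' B := by
  have key : ∀ {A : Set X}, IsPi0 (ξ + 1) A →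
      ∃ S : ℕ → Set X, (∀ n, IsSigma0 ξ (S n)) ∧ A = ⋂ n, S n := fun {A} hA => by
    obtain ⟨ν, S, h1, h2, h3, h4⟩ := IsSigma0.exists_iUnion hA (Order.lt_add_one_iff.2 hξ)
    refine ⟨fun n => (S n)ᶜ, fun n => (h3 n).mono (Order.lt_add_one_iff.1 (h2 n)), ?_⟩
    rw [← compl_iUnion, ← h4, compl_compl]
  obtain ⟨S, hS, rfl⟩ := key hA
  obtain ⟨T, hT, rfl⟩ := key hB
  choose k hk hko using fun n => (hS n).exists_refinement_isOpen t ht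
  choose m hm hmo using fun n => (hT n).exists_refinement_isOpen t ht
  -- Even indices carry the refinements for `A`, odd ones those for `B`.
  obtain ⟨t', h', hr⟩ := exists_isSigma0Refinement_forall_le t ht hξ
    (m := fun n => if Even n then k (n / 2) else m (n / 2)) fun n => by
      split_ifs
      · exact hk _
      · exact hm _
  have hk' : ∀ n, t' ≤ k n := fun n => by simpa using h' (2 * n)
  have hm' : ∀ n, t' ≤ m n := fun n => by
    have := h' (2 * n + 1)
    rwa [if_neg (by simp), show (2 * n + 1) / 2 = n by lia] at this
  exact ⟨t', hr, .iInter_of_isOpen fun n => hk' n _ (hko n),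
    .iInter_of_isOpen fun n => hm' n _ (hmo n)⟩

end Refinement

/-! ### Hausdorff derivatives and countability of the separation rank -/

section Derivative

variable {X : Type*} [TopologicalSpace X]

/-- Two disjoint `Gδ` sets cannot both be dense in a nonempty closed set. -/
theorem eq_empty_of_subset_closure_inter [PolishSpace X] {A B D : Set X} (hA : IsGδ A)
    (hB : IsGδ B) (hAB : Disjoint A B) (hD : IsClosed D) (h1 : D ⊆ closure (D ∩ A))
    (h2 : D ⊆ closure (D ∩ B)) : D = ∅ := by
  have : PolishSpace D := hD.polishSpace
  let := TopologicalSpace.upgradeIsCompletelyMetrizable D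
  have key : ∀ {A : Set X}, D ⊆ closure (D ∩ A) → Dense (Subtype.val ⁻¹' A : Set D) :=
    fun {A} h => by
      rw [Subtype.dense_iff, Subtype.image_preimage_coe]
      exact h
  have hd := (key h1).inter_of_Gδ (hA.preimage continuous_subtype_val)
    (hB.preimage continuous_subtype_val) (key h2)
  rw [← preimage_inter, hAB.inter_eq, preimage_empty] at hd
  refine eq_empty_of_forall_notMem fun x hx => ?_
  have := hd ⟨x, hx⟩
  rwa [closure_empty] at this

/-- The set of common limit points of `D ∩ A` and `D ∩ B`. -/
def sepDeriv (A B D : Set X) : Set X := closure (D ∩ A) ∩ closure (D ∩ B)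

/-- The transfinite iteration of `sepDeriv A B` starting from the whole space. -/
def iterSepDeriv (A B : Set X) (θ : Ordinal.{0}) : Set X :=
  ⋂ η : Iio θ, sepDeriv A B (iterSepDeriv A B η.1)
termination_by θ
decreasing_by exact η.2

theorem mem_iterSepDeriv {A B : Set X} {θ : Ordinal.{0}} {x : X} :
    x ∈ iterSepDeriv A B θ ↔ ∀ η < θ, x ∈ sepDeriv A B (iterSepDeriv A B η) := by
  rw [iterSepDeriv, mem_iInter, Subtype.forall]
  rfl

theorem isClosed_iterSepDeriv (A B : Set X) (θ : Ordinal.{0}) : IsClosed (iterSepDeriv A B θ) := by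
  rw [iterSepDeriv]
  exact isClosed_iInter fun η => isClosed_closure.inter isClosed_closure

theorem iterSepDeriv_antitone (A B : Set X) : Antitone (iterSepDeriv A B) := fun θ η h x hx => by
  rw [mem_iterSepDeriv] at hx ⊢
  exact fun ζ hζ => hx ζ (hζ.trans_le h)

/-- The Lindelöf property makes the decreasing closed sets constant from some countable stage on.
There both `A` and `B` are dense in the set, so it is empty by Baire category. -/
theorem exists_iterSepDeriv_eq_empty [PolishSpace X] {A B : Set X} (hA : IsGδ A) (hB : IsGδ B)
    (hAB : Disjoint A B) : ∃ θ < ω₁, iterSepDeriv A B θ = ∅ := by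
  obtain ⟨T, hT, hTU⟩ := TopologicalSpace.isOpen_iUnion_countable
    (fun θ : Iio (ω₁ : Ordinal.{0}) => (iterSepDeriv A B θ.1)ᶜ)
    fun θ => (isClosed_iterSepDeriv A B θ.1).isOpen_compl
  have := hT.to_subtype
  have hlt : ⨆ θ : T, θ.1.1 < ω₁ := Ordinal.iSup_lt_omega_one fun θ => θ.1.2
  refine ⟨_, hlt, ?_⟩
  have hstab : ∀ η < ω₁, iterSepDeriv A B (⨆ θ : T, θ.1.1) ⊆ iterSepDeriv A B η := by
    intro η hη x hx
    by_contra hxη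
    have : x ∈ ⋃ θ ∈ T, (iterSepDeriv A B θ.1)ᶜ := by
      rw [hTU]
      exact mem_iUnion.2 ⟨⟨η, hη⟩, hxη⟩
    obtain ⟨θ, hθ, hxθ⟩ := mem_iUnion₂.1 this
    exact hxθ (iterSepDeriv_antitone A B (Ordinal.le_iSup (fun θ : T => θ.1.1) ⟨θ, hθ⟩) hx)
  have hsucc : (⨆ θ : T, θ.1.1) + 1 < ω₁ :=
    (Cardinal.isSuccLimit_omega 1).add_one_lt hlt
  have hsub : iterSepDeriv A B (⨆ θ : T, θ.1.1) ⊆ sepDeriv A B (iterSepDeriv A B (⨆ θ : T, θ.1.1)) :=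
    fun x hx => mem_iterSepDeriv.1 (hstab _ hsucc hx) _ (Order.lt_add_one_iff.2 le_rfl)
  exact eq_empty_of_subset_closure_inter hA hB hAB (isClosed_iterSepDeriv A B _)
    (hsub.trans inter_subset_left) (hsub.trans inter_subset_right)

/-- Hausdorff's analysis: two disjoint `Gδ` sets are separated by a set described by countably
many closed sets. -/
theorem exists_closed_rank_separation [PolishSpace X] {A B : Set X} (hA : IsGδ A) (hB : IsGδ B)
    (hAB : Disjoint A B) : ∃ θ < ω₁, ∃ (d : X → Ordinal.{0}) (C : Set X), (∀ x, d x < θ) ∧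
      (∀ γ, IsClosed {x | γ ≤ d x}) ∧ (∀ γ, IsClosed {x | γ < d x ∨ γ = d x ∧ x ∉ C}) ∧
      A ⊆ C ∧ C ⊆ Bᶜ := by
  obtain ⟨θ, hθ, hempty⟩ := exists_iterSepDeriv_eq_empty hA hB hAB
  set D := iterSepDeriv A B
  let d : X → Ordinal.{0} := fun x => sInf {η | x ∉ sepDeriv A B (D η)}
  have hne : ∀ x, ∃ η < θ, x ∉ sepDeriv A B (D η) := fun x => by
    have : x ∉ D θ := by rw [hempty]; exact notMem_empty x
    rw [mem_iterSepDeriv] at this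
    push Not at this
    exact this
  have hd : ∀ x, x ∉ sepDeriv A B (D (d x)) := fun x =>
    csInf_mem (s := {η | x ∉ sepDeriv A B (D η)}) (let ⟨η, _, h⟩ := hne x; ⟨η, h⟩)
  have hmem : ∀ x γ, x ∈ D γ ↔ γ ≤ d x := fun x γ => by
    rw [mem_iterSepDeriv]
    refine ⟨fun h => ?_, fun h η hη => ?_⟩
    · by_contra! hlt
      exact hd x (h _ hlt)
    · by_contra hx
      exact notMem_of_lt_csInf' (hη.trans_le h) hx
  -- At stage `d x` the point misses one of the two closures. A point of `A` lies in the closure for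
  -- `A`, so it misses the one for `B`; a point of `B` lies in that one.
  refine ⟨θ, hθ, d, {x | x ∉ closure (D (d x) ∩ B)}, fun x => ?_, fun γ => ?_, fun γ => ?_,
    fun x hx hcl => ?_, fun x hx hxB => ?_⟩
  · obtain ⟨η, hη, h⟩ := hne x
    exact (csInf_le' h).trans_lt hη
  · have : {x | γ ≤ d x} = D γ := by ext x; exact (hmem x γ).symm
    rw [this]
    exact isClosed_iterSepDeriv A B γ
  · have : {x | γ < d x ∨ γ = d x ∧ x ∉ {x | x ∉ closure (D (d x) ∩ B)}} =
        closure (D γ ∩ B) := by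
      ext x
      simp only [mem_ofPred_eq, not_not]
      constructor
      · rintro (h | ⟨rfl, h⟩)
        · exact (mem_iterSepDeriv.1 ((hmem x _).2 le_rfl) γ h).2
        · exact h
      · intro h
        have hγ : γ ≤ d x := (hmem x γ).1
          (closure_minimal inter_subset_left (isClosed_iterSepDeriv A B γ) h)
        rcases hγ.eq_or_lt with rfl | hlt
        · exact .inr ⟨rfl, h⟩
        · exact .inl hlt
    rw [this]
    exact isClosed_closure
  · exact hd x ⟨subset_closure ⟨(hmem x _).2 le_rfl, hx⟩, hcl⟩
  · exact hx (subset_closure ⟨(hmem x _).2 le_rfl, hxB⟩)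

/-- Disjoint `Π⁰_{ξ+1}` sets have countable separation rank. -/
theorem sepRankSets_lt_omega_one [PolishSpace X] {ξ : Ordinal.{0}} (hξ : 1 ≤ ξ) {A B : Set X}
    (hA : IsPi0 (ξ + 1) A) (hB : IsPi0 (ξ + 1) B) (hAB : Disjoint A B) :
    sepRankSets ξ A B < ω₁ := by
  have hrank : ∃ θ < ω₁, ∃ (d : X → Ordinal.{0}) (C : Set X), (∀ x, d x < θ) ∧
      (∀ γ, IsPi0 ξ {x | γ ≤ d x}) ∧ (∀ γ, IsPi0 ξ {x | γ < d x ∨ γ = d x ∧ x ∉ C}) ∧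
      A ⊆ C ∧ C ⊆ Bᶜ := by
    obtain ⟨t', hr, hA', hB'⟩ := exists_refinement_isGδ _ ‹_› hξ hA hB
    obtain ⟨θ, hθ, d, C, hd, h1, h2, hC⟩ :=
      @exists_closed_rank_separation X t' hr.polishSpace A B hA' hB' hAB
    exact ⟨θ, hθ, d, C, hd, fun γ => hr.isSigma0 _ (h1 γ).isOpen_compl,
      fun γ => hr.isSigma0 _ (h2 γ).isOpen_compl, hC⟩
  obtain ⟨θ, hθ, d, C, hd, h1, h2, hAC, hCB⟩ := hrank
  obtain ⟨η, hη, hη', hθL⟩ := exists_le_omega0_opow hθ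
  have hL := omega0_opow_lt_omega_one hη'
  exact (sepRankSets_le hL (isRanked_of_rank d
    (fun x => two_mul_add_one_lt_omega0_opow hη ((hd x).trans_le hθL)) h1
    h2) hAC hCB).trans_lt hL

end Derivative

/-! ### Comparison of the two ranks -/

section Comparison

variable {X : Type*} [TopologicalSpace X]

theorem isRanked_empty {ξ L : Ordinal.{0}} (hξ : 1 ≤ ξ) (hL : 1 < L) [PolishSpace X] :
    IsRanked ξ L (∅ : Set X) := by
  -- Rank `0` is even, so the empty set needs the constant rank `1`.
  refine ⟨fun _ => 1, fun _ => hL, fun γ => ?_, fun x => ?_⟩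
  · by_cases h : γ ≤ 1
    · simpa [h, IsPi0] using IsSigma0.empty hξ
    · simpa [h, IsPi0] using IsSigma0.univ hξ
  · have := not_isEvenOrd_two_mul_add_one 0
    simpa using this

theorem isRanked_biUnion [PolishSpace X] {ξ η : Ordinal.{0}} (hξ : 1 ≤ ξ) (hη : 1 ≤ η)
    {ι : Type*} (s : Finset ι) {A : ι → Set X} (hA : ∀ i ∈ s, IsRanked ξ (ω ^ η) (A i)) :
    IsRanked ξ (ω ^ η) (⋃ i ∈ s, A i) := by
  classical
  induction s using Finset.induction_on with
  | empty =>
    simpa using isRanked_empty hξ (Ordinal.one_lt_opow.2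
      ⟨Ordinal.one_lt_omega0, (Order.one_le_iff_pos.1 hη).ne'⟩)
  | insert i s _ ih =>
    rw [Finset.set_biUnion_insert]
    exact (hA i (Finset.mem_insert_self _ _)).boolean hξ hη
      (ih fun j hj => hA j (Finset.mem_insert_of_mem hj)) Or fun _ => Iff.rfl

theorem sepRankSets_le_sepRank {ξ : Ordinal.{0}} (f : X → ℝ) {p q : ℚ} (hpq : p < q) :
    sepRankSets ξ {x | f x ≤ (p : ℝ)} {x | (q : ℝ) ≤ f x} ≤ sepRank ξ f :=
  Ordinal.le_iSup (fun r : {r : ℚ × ℚ // r.1 < r.2} =>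
    sepRankSets ξ {x | f x ≤ (r.1.1 : ℝ)} {x | (r.1.2 : ℝ) ≤ f x}) ⟨(p, q), hpq⟩

theorem sepRank_lt_omega_one [PolishSpace X] {ξ : Ordinal.{0}} (hξ : 1 ≤ ξ) {f : X → ℝ}
    (hf : IsBaireClass ξ f) : sepRank ξ f < ω₁ := by
  refine Ordinal.iSup_lt_omega_one fun r => sepRankSets_lt_omega_one hξ ?_ ?_ ?_
  · rw [IsPi0, show {x | f x ≤ (r.1.1 : ℝ)}ᶜ = {x | (r.1.1 : ℝ) < f x} by ext; simp]
    exact (hf.isSigma0 _).1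
  · rw [IsPi0, show {x | (r.1.2 : ℝ) ≤ f x}ᶜ = {x | f x < (r.1.2 : ℝ)} by ext; simp]
    exact (hf.isSigma0 _).2
  · refine Set.disjoint_left.2 fun x (h1 : f x ≤ _) (h2 : _ ≤ f x) => ?_
    exact absurd (h2.trans h1) (not_le.2 (by exact_mod_cast r.2))

/-- If `α_ξ(f) ≤ ω ^ η` then suitable partitions into sets of rank at most `ω ^ η` exist. -/
theorem finPartRankAt_le_of_sepRank_le [PolishSpace X] {ξ η : Ordinal.{0}} (hξ : 1 ≤ ξ)
    (hη : 1 ≤ η) (hη' : η < ω₁) {f : X → ℝ} (hbdd : ∃ M : ℝ, ∀ x, |f x| ≤ M)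
    (h : sepRank ξ f ≤ ω ^ η) {ε : ℝ} (hε : 0 < ε) : finPartRankAt ξ f ε ≤ ω ^ η := by
  obtain ⟨M, hM⟩ := hbdd
  have hω := omega0_opow_lt_omega_one hη'
  obtain ⟨δ, hδ0, hδ⟩ : ∃ δ : ℚ, 0 < δ ∧ (δ : ℝ) < ε := by
    obtain ⟨δ, h1, h2⟩ := exists_rat_btwn hε
    exact ⟨δ, by exact_mod_cast h1, h2⟩
  obtain ⟨m, hm⟩ := exists_rat_lt (-M)
  -- The grid starts below `-M` and has step less than `ε`, so the first separator containing `x`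
  -- locates `f x` within `ε`: `C n` bounds it above by `p (n + 1)`, and missing the previous
  -- separator bounds it below by `p (n - 1)`, or `-M` does when `n = 0`.
  let p : ℕ → ℚ := fun n => m + n * δ
  have hp : ∀ n, p (n + 1) = p n + δ := fun n => by simp only [p]; push_cast; ring
  have hpR : ∀ n, (p (n + 1) : ℝ) = p n + δ := fun n => by rw [hp]; push_cast; ring
  obtain ⟨N, hN⟩ : ∃ N : ℕ, M ≤ (p N : ℝ) := by
    obtain ⟨N, hN⟩ := exists_nat_ge ((M - m) / δ)
    refine ⟨N, ?_⟩
    rw [div_le_iff₀ (by exact_mod_cast hδ0)] at hN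
    simp only [p]; push_cast; linarith
  have hsep : ∀ n, ∃ C : Set X, IsRanked ξ (ω ^ η) C ∧ {x | f x ≤ (p n : ℝ)} ⊆ C ∧
      C ⊆ {x | (p (n + 1) : ℝ) ≤ f x}ᶜ := fun n =>
    exists_isRanked_of_sepRankSets_le hξ hω
      ((sepRankSets_le_sepRank f (by rw [hp]; linarith)).trans h)
  choose C hC hC1 hC2 using hsep
  have hrank : ∀ n, IsRanked ξ (ω ^ η) (disjointed C n) := fun n =>
    disjointedRec (fun {_ i} ht => ht.boolean hξ hη (hC i) (fun a b => a ∧ ¬ b) fun _ => Iff.rfl)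
      (hC n)
  have hmem : ∀ n x, x ∈ disjointed C n ↔ x ∈ C n ∧ ∀ k < n, x ∉ C k := fun n x => by
    rw [disjointed_eq_inter_compl]
    simp
  have hin : ∀ n x, x ∈ disjointed C n → |f x - p n| ≤ ε := fun n x hx => by
    obtain ⟨h1, h2⟩ := (hmem n x).1 hx
    have h3 : f x < p (n + 1) := not_le.1 (hC2 n h1)
    rw [hpR] at h3
    rw [abs_le]
    refine ⟨?_, by linarith⟩
    cases n with
    | zero =>
      have h4 := (abs_le.1 (hM x)).1
      have h5 : (p 0 : ℝ) = m := by simp [p]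
      linarith
    | succ k =>
      have h4 : (p k : ℝ) < f x := not_le.1 fun h => h2 k k.lt_succ_self (hC1 k h)
      rw [hpR]
      linarith
  have hdisj : ∀ n k : Fin (N + 1), n ≠ k → disjointed C n ∩ disjointed C k = ∅ :=
    fun n k hnk => (disjoint_disjointed C fun h => hnk (Fin.ext h)).inter_eq
  have hcover : ∀ x, ∃ n : Fin (N + 1), x ∈ disjointed C n := fun x => by
    classical
    have hx : x ∈ C N := hC1 N ((le_abs_self _).trans ((hM x).trans hN))
    have hex : ∃ n, x ∈ C n := ⟨N, hx⟩
    exact ⟨⟨Nat.find hex, Nat.lt_succ_of_le (Nat.find_min' hex hx)⟩,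
      (hmem _ x).2 ⟨Nat.find_spec hex, fun k hk => Nat.find_min hex hk⟩⟩
  have hpart : IsApproxPartition ξ f ε N fun n : Fin (N + 1) => disjointed C n := by
    refine ⟨fun n => (hrank n).isDelta0 hξ hω, eq_univ_of_forall fun x => mem_iUnion.2 (hcover x),
      hdisj, fun n => p n, fun x => ?_⟩
    obtain ⟨n, hn⟩ := hcover x
    rw [Finset.sum_eq_single n (fun k _ hk => ?_) (by simp), indicator_of_mem hn, mul_one]
    · exact hin n x hn
    rw [indicator_of_notMem, mul_zero]
    exact fun hxk => (hdisj k n hk).le ⟨hxk, hn⟩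
  refine (csInf_le' (.inr ⟨N, _, hpart, rfl⟩)).trans (Ordinal.iSup_le fun n => ?_)
  exact sepRankSets_le hω (hrank n) le_rfl (by rw [compl_compl])

theorem finPartRankAt_le_finPartRank {ξ : Ordinal.{0}} (f : X → ℝ) {ε : ℝ}
    (hε : 0 < ε) : finPartRankAt ξ f ε ≤ finPartRank ξ f :=
  Ordinal.le_iSup (fun ε : {ε : ℝ // 0 < ε} => finPartRankAt ξ f ε) ⟨ε, hε⟩

theorem sepRank_le_of_finPartRank_le [PolishSpace X] {ξ η : Ordinal.{0}} (hξ : 1 ≤ ξ)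
    (hη : 1 ≤ η) (hη' : η < ω₁) {f : X → ℝ} (h : finPartRank ξ f ≤ ω ^ η) :
    sepRank ξ f ≤ ω ^ η := by
  classical
  have hω := omega0_opow_lt_omega_one hη'
  refine Ordinal.iSup_le fun ⟨⟨p, q⟩, hpq⟩ => ?_
  replace hpq : (p : ℝ) < q := by exact_mod_cast hpq
  -- Any tolerance below half the gap lets the midpoint tell the pieces meeting `f ≤ p` from those
  -- meeting `q ≤ f`.
  have hε : (0 : ℝ) < (q - p) / 3 := by linarith
  have hat := (finPartRankAt_le_finPartRank f hε).trans h
  rcases csInf_mem (insert_nonempty ω₁ {r : Ordinal.{0} | ∃ (N : ℕ) (H : Fin (N + 1) → Set X),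
    IsApproxPartition ξ f ((q - p) / 3) N H ∧ r = ⨆ n, sepRankSets ξ (H n) (H n)ᶜ}) with
    h1 | ⟨N, H, hH, h1⟩
  · exact absurd (hat.trans_lt hω) h1.ge.not_gt
  have hle : ⨆ n, sepRankSets ξ (H n) (H n)ᶜ ≤ ω ^ η := h1 ▸ hat
  have hrank : ∀ n, IsRanked ξ (ω ^ η) (H n) := fun n => by
    obtain ⟨C, hC, h2, h3⟩ := exists_isRanked_of_sepRankSets_le hξ hω
      ((Ordinal.le_iSup (fun n => sepRankSets ξ (H n) (H n)ᶜ) n).trans hle)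
    rw [compl_compl] at h3
    rwa [h2.antisymm h3]
  obtain ⟨c, hc⟩ := hH.approx
  have hval : ∀ n, ∀ x ∈ H n, |f x - c n| ≤ (q - p) / 3 := fun n x hx => by
    have := hc x
    rwa [Finset.sum_eq_single n (fun k _ hk => ?_) (by simp), indicator_of_mem hx,
      mul_one] at this
    rw [indicator_of_notMem, mul_zero]
    intro hxk
    have : x ∈ H k ∩ H n := ⟨hxk, hx⟩
    rwa [hH.disjoint k n hk] at this
  refine sepRankSets_le hω (isRanked_biUnion hξ hη
    (Finset.univ.filter fun n => c n ≤ (p + q) / 2) fun n _ => hrank n) ?_ ?_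
  · intro x (hx : f x ≤ p)
    obtain ⟨n, hn⟩ := mem_iUnion.1 (hH.iUnion_eq.ge (mem_univ x))
    refine mem_iUnion₂.2 ⟨n, ?_, hn⟩
    have := abs_le.1 (hval n x hn)
    simp only [Finset.mem_filter, Finset.mem_univ, true_and]
    linarith
  · intro x hx (hqx : q ≤ f x)
    obtain ⟨n, hn, hxn⟩ := mem_iUnion₂.1 hx
    have := abs_le.1 (hval n x hxn)
    simp only [Finset.mem_filter, Finset.mem_univ, true_and] at hn
    linarith

end Comparison

end BaireRank

theorem mainTheorem12 {X : Type*} [TopologicalSpace X] [PolishSpace X] [Uncountable X]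
    (ξ : Ordinal.{0}) (hξ : 1 ≤ ξ) (hξ' : ξ < Ordinal.omega 1)
    (f : X → ℝ) (hf : BaireRank.IsBaireClass ξ f) (hbdd : ∃ M : ℝ, ∀ x, |f x| ≤ M) :
    BaireRank.finPartRank ξ f < Ordinal.omega 1 ∧ BaireRank.sepRank ξ f < Ordinal.omega 1 ∧
      BaireRank.EssEq (BaireRank.finPartRank ξ f) (BaireRank.sepRank ξ f) := by
  have h1 := BaireRank.sepRank_lt_omega_one hξ hf
  have h2 : ∀ η, 1 ≤ η → η < ω₁ → BaireRank.sepRank ξ f ≤ ω ^ η →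
      BaireRank.finPartRank ξ f ≤ ω ^ η := fun η hη hη' h => Ordinal.iSup_le fun ε =>
    BaireRank.finPartRankAt_le_of_sepRank_le hξ hη hη' hbdd h ε.2
  -- The supremum over all real `ε` is countable because one bound `ω ^ η` serves every `ε`.
  obtain ⟨η, hη, hη', hle⟩ := BaireRank.exists_le_omega0_opow h1
  exact ⟨(h2 η hη hη' hle).trans_lt (BaireRank.omega0_opow_lt_omega_one hη'), h1, h2,
    fun η hη hη' h => BaireRank.sepRank_le_of_finPartRank_le hξ hη hη' h⟩
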